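/- Let $A$ be an integral $m\times d$ matrix and let $\mathcal K=\{\mathbf r\in\mathbb R^d : A\mathbf r\le 0\}$ be the rational cone it defines. Assume that $\mathcal K$ is $d$-dimensional and pointed, i.e. that $\mathcal K$ contains no line. Let $\mathcal K^\circ$ be the (topological) interior of $\mathcal K$, and for $S\in\{\mathcal K,\mathcal K^\circ\}$ let $$\sigma_S(\mathbf x)=\sum_{\mathbf m\in S\cap\mathbb Z^d}\mathbf x^{\mathbf m},\qquad \mathbf x^{\mathbf m}=x_1^{m_1}\cdots x_d^{m_d},$$ a formal Laurent series. Then $\sigma_{\mathcal K}$ and $\sigma_{\mathcal K^\circ}$ each represent a unique rational function in $\mathbb C(x_1,\dots,x_d)$, where a formal series $f$ represents the rational function $F$ if there are Laurent polynomials $p$ and $q\neq 0$ with $q f=p$ and $F=p/q$; and, as rational functions, $$\sigma_{\mathcal K}(\mathbf x)=(-1)^d\,\sigma_{\mathcal K^\circ}(1/\mathbf x),\qquad 1/\mathbf x=(1/x_1,\dots,1/x_d).$$ -/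

import Mathlib

noncomputable section

namespace StanleyReciprocity

/-- The cone `{r ∈ ℝ^d : A r ≤ 0}` of an integral `m × d` matrix `A`. -/
def rationalCone {m d : ℕ} (A : Matrix (Fin m) (Fin d) ℤ) : Set (Fin d → ℝ) :=
  {r | ∀ i, ((A.map (Int.cast : ℤ → ℝ)).mulVec r) i ≤ 0}

/-- The set contains no (affine) line. -/
def ContainsNoLine {d : ℕ} (K : Set (Fin d → ℝ)) : Prop :=
  ¬ ∃ p v : Fin d → ℝ, v ≠ 0 ∧ ∀ t : ℝ, p + t • v ∈ K

/-- Laurent polynomials in `x_1, …, x_d` over `ℂ`: the exponent vector `m ∈ ℤ^d` corresponds to the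
monomial `x^m`. -/
abbrev Laurent (d : ℕ) : Type := AddMonoidAlgebra ℂ (Fin d → ℤ)

/-- The field `ℂ(x_1, …, x_d)` of rational functions, as the fraction field of the ring of
Laurent polynomials. -/
abbrev RationalFunction (d : ℕ) : Type := FractionRing (Laurent d)

/-- The substitution `x ↦ 1/x` on Laurent polynomials: `x^m ↦ x^(-m)`. -/
def Laurent.invVars (d : ℕ) : Laurent d ≃ₐ[ℂ] Laurent d :=
  AddMonoidAlgebra.domCongr ℂ ℂ (AddEquiv.neg (Fin d → ℤ))

/-- The substitution `x ↦ 1/x` on rational functions: `p(x)/q(x) ↦ p(1/x)/q(1/x)`. -/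
def RationalFunction.invVars (d : ℕ) : RationalFunction d ≃+* RationalFunction d :=
  IsFractionRing.ringEquivOfRingEquiv (Laurent.invVars d).toRingEquiv

/-- Formal (two-sided) Laurent series in `x_1, …, x_d`, given by their coefficients: the function
`f` stands for `∑_{m ∈ ℤ^d} f(m) x^m`. -/
abbrev FormalSeries (d : ℕ) : Type := (Fin d → ℤ) → ℂ

/-- The formal series `σ_S(x) = ∑_{m ∈ S ∩ ℤ^d} x^m` of the lattice points of a set `S ⊆ ℝ^d`. -/
def latticeSeries {d : ℕ} (S : Set (Fin d → ℝ)) : FormalSeries d :=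
  Set.indicator {m | (fun i => (m i : ℝ)) ∈ S} 1

/-- The product of a Laurent polynomial and a formal series; the coefficient of `x^m` is the finite
sum `∑_n q_n f(m - n)`. -/
def laurentMul {d : ℕ} (q : Laurent d) (f : FormalSeries d) : FormalSeries d :=
  fun m => q.coeff.sum fun n c => c * f (m - n)

/-- The formal series `f` is (the expansion of) the rational function `F`: there are Laurent
polynomials `p` and `q ≠ 0` with `q f = p` and `F = p / q`. -/
def IsExpansionOf {d : ℕ} (f : FormalSeries d) (F : RationalFunction d) : Prop :=
  ∃ p q : Laurent d, q ≠ 0 ∧ laurentMul q f = (fun m => p.coeff m) ∧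
    F = algebraMap (Laurent d) (RationalFunction d) p /
      algebraMap (Laurent d) (RationalFunction d) q

end StanleyReciprocity

end

namespace StanleyReciprocity

/-! ### Formal series as a module over the Laurent polynomials -/

section Series

variable {d : ℕ}

/-! Choose `w` in the interior of the cone at which no nonzero integral form vanishes, and put `φ =
formEval w`. Perturbing by `φ` decides, for every form, on which side its hyperplane is counted: the
half-spaces of the forms `-A i ≠ 0` are closed for `φ` and open for `-φ`. So one cone construction
gives the lattice points of the cone for `φ` and those of its interior for `-φ`.

Pointedness yields `d` independent rows, hence a simplicial cone containing the given one. Imposing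
the other inequalities one at a time, and subdividing when a form changes sign on the generators,
cuts it into half-open simplicial cones (`IsDualPair.reciprocal_halfOpenCone`). No
inclusion-exclusion arises, since each boundary point lies in exactly one piece.

For a half-open simplicial cone, the series is a box polynomial over `∏ (1 - x^(v i))`. The
reflection `x ↦ ∑ v i - x` exchanges the boxes of complementary half-open cones, and each
denominator factor contributes a sign (`IsDualPair.reciprocal`). -/

lemma laurentMul_zero_left (f : FormalSeries d) : laurentMul 0 f = 0 := by
  ext m; simp [laurentMul]

lemma laurentMul_add_left (p q : Laurent d) (f : FormalSeries d) :
    laurentMul (p + q) f = laurentMul p f + laurentMul q f := by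
  ext m
  simp only [laurentMul, AddMonoidAlgebra.coeff_add, Pi.add_apply]
  exact Finsupp.sum_add_index' (by simp) (by intros; ring)

lemma laurentMul_add_right (q : Laurent d) (f g : FormalSeries d) :
    laurentMul q (f + g) = laurentMul q f + laurentMul q g := by
  ext m
  simp [laurentMul, mul_add, Finsupp.sum_add]

lemma laurentMul_single (n : Fin d → ℤ) (c : ℂ) (f : FormalSeries d) (m : Fin d → ℤ) :
    laurentMul (AddMonoidAlgebra.single n c) f m = c * f (m - n) := by
  simp [laurentMul]

lemma laurentMul_one (f : FormalSeries d) : laurentMul 1 f = f := by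
  ext m
  rw [AddMonoidAlgebra.one_def, laurentMul_single]
  simp

lemma laurentMul_mul (p q : Laurent d) (f : FormalSeries d) :
    laurentMul (p * q) f = laurentMul p (laurentMul q f) := by
  induction p using AddMonoidAlgebra.induction_linear with
  | zero => simp [laurentMul_zero_left]
  | add p p' hp hp' => simp [add_mul, laurentMul_add_left, hp, hp']
  | single n c =>
    induction q using AddMonoidAlgebra.induction_linear with
    | zero =>
      ext m
      simp [laurentMul_zero_left, laurentMul_single]
    | add q q' hq hq' => simp [mul_add, laurentMul_add_left, laurentMul_add_right, hq, hq']
    | single n' c' =>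
      ext m
      rw [AddMonoidAlgebra.single_mul_single]
      simp [laurentMul_single, mul_assoc, sub_sub]

lemma laurentMul_coeff (q p : Laurent d) :
    laurentMul q (fun m => p.coeff m) = fun m => (q * p).coeff m := by
  -- A Laurent polynomial is its own product with the series `1`, so the claim reduces to
  -- associativity.
  have h (p : Laurent d) : (fun m => p.coeff m) = laurentMul p (Pi.single 0 1) := by
    ext m
    induction p using AddMonoidAlgebra.induction_linear with
    | zero => simp [laurentMul_zero_left]
    | add p p' hp hp' => simp [laurentMul_add_left, hp, hp']
    | single n c =>
      simp [laurentMul_single, Finsupp.single_apply, Pi.single_apply, sub_eq_zero, eq_comm]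
  rw [h p, h (q * p), laurentMul_mul]

/-- A formal series expands at most one rational function. -/
lemma IsExpansionOf.unique {f : FormalSeries d} {F F' : RationalFunction d}
    (h : IsExpansionOf f F) (h' : IsExpansionOf f F') : F = F' := by
  obtain ⟨p, q, hq, hf, rfl⟩ := h
  obtain ⟨p', q', hq', hf', rfl⟩ := h'
  have key : q' * p = q * p' := by
    -- Computing `q' q f` in two ways cross-multiplies the two fractions.
    have e : laurentMul q' (laurentMul q f) = laurentMul q (laurentMul q' f) := by
      rw [← laurentMul_mul, ← laurentMul_mul, mul_comm]
    rw [hf, hf', laurentMul_coeff, laurentMul_coeff] at e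
    exact AddMonoidAlgebra.ext (DFunLike.coe_injective e)
  have inj := IsFractionRing.injective (Laurent d) (RationalFunction d)
  rw [div_eq_div_iff ((map_ne_zero_iff _ inj).2 hq) ((map_ne_zero_iff _ inj).2 hq'), ← map_mul,
    ← map_mul, mul_comm p, mul_comm p', key]

lemma IsExpansionOf.add {f f' : FormalSeries d} {F F' : RationalFunction d}
    (h : IsExpansionOf f F) (h' : IsExpansionOf f' F') : IsExpansionOf (f + f') (F + F') := by
  obtain ⟨p, q, hq, hf, rfl⟩ := h
  obtain ⟨p', q', hq', hf', rfl⟩ := h'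
  have inj := IsFractionRing.injective (Laurent d) (RationalFunction d)
  refine ⟨p * q' + q * p', q * q', mul_ne_zero hq hq', ?_, ?_⟩
  · rw [laurentMul_add_right, laurentMul_mul q q' f', hf', mul_comm q q', laurentMul_mul, hf,
      laurentMul_coeff, laurentMul_coeff, mul_comm q' p]
    ext m
    simp
  · rw [div_add_div _ _ ((map_ne_zero_iff _ inj).2 hq) ((map_ne_zero_iff _ inj).2 hq')]
    simp

lemma isExpansionOf_zero : IsExpansionOf (0 : FormalSeries d) 0 :=
  ⟨0, 1, one_ne_zero, by rw [laurentMul_one]; ext; simp, by simp⟩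

lemma Laurent.invVars_single (n : Fin d → ℤ) (c : ℂ) :
    Laurent.invVars d (AddMonoidAlgebra.single n c) = AddMonoidAlgebra.single (-n) c := by
  simp [Laurent.invVars]

lemma RationalFunction.invVars_div (p q : Laurent d) :
    RationalFunction.invVars d (algebraMap (Laurent d) (RationalFunction d) p /
      algebraMap (Laurent d) (RationalFunction d) q) =
    algebraMap (Laurent d) (RationalFunction d) (Laurent.invVars d p) /
      algebraMap (Laurent d) (RationalFunction d) (Laurent.invVars d q) := by
  simp [RationalFunction.invVars]

/-- The series of the sets `S` and `T` of lattice points expand rational functions that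
correspond to each other under `F(x) = (-1)^d G(1/x)`. -/
def Reciprocal (S T : Set (Fin d → ℤ)) : Prop :=
  ∃ F G : RationalFunction d, IsExpansionOf (S.indicator 1) F ∧ IsExpansionOf (T.indicator 1) G ∧
    F = (-1) ^ d * RationalFunction.invVars d G

lemma reciprocal_empty : Reciprocal (∅ : Set (Fin d → ℤ)) ∅ :=
  ⟨0, 0, by rw [Set.indicator_empty']; exact isExpansionOf_zero,
    by rw [Set.indicator_empty']; exact isExpansionOf_zero, by simp⟩

lemma Reciprocal.union {S S' T T' : Set (Fin d → ℤ)} (h : Reciprocal S T) (h' : Reciprocal S' T')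
    (hS : Disjoint S S') (hT : Disjoint T T') : Reciprocal (S ∪ S') (T ∪ T') := by
  obtain ⟨F, G, hF, hG, e⟩ := h
  obtain ⟨F', G', hF', hG', e'⟩ := h'
  refine ⟨F + F', G + G', ?_, ?_, ?_⟩
  · rw [Set.indicator_union_of_disjoint hS]
    exact hF.add hF'
  · rw [Set.indicator_union_of_disjoint hT]
    exact hG.add hG'
  · rw [e, e', map_add, mul_add]

end Series

end StanleyReciprocity

namespace StanleyReciprocity

/-! ### Simplicial cones -/

section Simplicial

variable {d : ℕ}

/-- The vectors `v j` generate the simplicial cone whose facets are given by the forms `b i`. -/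
structure IsDualPair (b v : Fin d → Fin d → ℤ) : Prop where
  pos : ∀ i, 0 < b i ⬝ᵥ v i
  orthogonal : ∀ i j, i ≠ j → b i ⬝ᵥ v j = 0

/-- The product of the factors `1 - x^(v i)`. -/
noncomputable def denominator (v : Fin d → Fin d → ℤ) (J : Finset (Fin d)) : Laurent d :=
  ∏ i ∈ J, (1 - AddMonoidAlgebra.single (v i) 1)

/-- The lattice points of a shifted simplicial cone that lie in the fundamental
parallelepiped with respect to the directions in `J`. -/
def partialBox (b v : Fin d → Fin d → ℤ) (e : Fin d → ℤ) (J : Finset (Fin d)) :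
    Set (Fin d → ℤ) :=
  {x | (∀ i, e i ≤ b i ⬝ᵥ x) ∧ ∀ i ∈ J, b i ⬝ᵥ x < e i + b i ⬝ᵥ v i}

lemma IsDualPair.denominator_ne_zero {b v : Fin d → Fin d → ℤ} (h : IsDualPair b v)
    (J : Finset (Fin d)) : denominator v J ≠ 0 := by
  refine Finset.prod_ne_zero_iff.2 fun i _ => ?_
  rw [sub_ne_zero, AddMonoidAlgebra.one_def]
  intro e
  have hv : v i = 0 := by
    by_contra hne
    have := congrArg (fun p : Laurent d => p.coeff 0) e
    simp [hne] at this
  have := h.pos i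
  simp [hv] at this

/-- Multiplying by `1 - x^(v j)` subtracts the translate by `v j`. By orthogonality this translation
changes only the value of `b j`, so what survives is a slab in that direction. -/
lemma IsDualPair.laurentMul_denominator {b v : Fin d → Fin d → ℤ} (h : IsDualPair b v)
    (e : Fin d → ℤ) (J : Finset (Fin d)) :
    laurentMul (denominator v J) ({x | ∀ i, e i ≤ b i ⬝ᵥ x}.indicator 1) =
      (partialBox b v e J).indicator 1 := by
  classical
  induction J using Finset.induction_on with
  | empty => simp [denominator, partialBox, laurentMul_one]
  | insert j J hj ih =>
    rw [denominator, Finset.prod_insert hj, laurentMul_mul, ← denominator, ih]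
    have hsub : (1 - AddMonoidAlgebra.single (v j) 1 : Laurent d) =
        1 + AddMonoidAlgebra.single (v j) (-1) := by
      rw [AddMonoidAlgebra.single_neg, sub_eq_add_neg]
    ext x
    rw [hsub, laurentMul_add_left, Pi.add_apply, laurentMul_one, laurentMul_single]
    have hpos := h.pos j
    have hmem : x - v j ∈ partialBox b v e J ↔
        x ∈ partialBox b v e J ∧ e j + b j ⬝ᵥ v j ≤ b j ⬝ᵥ x := by
      have ho (i) (hi : i ≠ j) : b i ⬝ᵥ (x - v j) = b i ⬝ᵥ x := by
        rw [dotProduct_sub, h.orthogonal i j hi, sub_zero]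
      have hjj : b j ⬝ᵥ (x - v j) = b j ⬝ᵥ x - b j ⬝ᵥ v j := dotProduct_sub ..
      constructor
      · rintro ⟨h1, h2⟩
        have := h1 j
        refine ⟨⟨fun i => ?_, fun i hi => ?_⟩, by omega⟩
        · by_cases hi : i = j
          · subst hi; omega
          · rw [← ho i hi]; exact h1 i
        · have hi' : i ≠ j := fun e => hj (e ▸ hi)
          rw [← ho i hi']; exact h2 i hi
      · rintro ⟨⟨h1, h2⟩, h3⟩
        refine ⟨fun i => ?_, fun i hi => ?_⟩
        · by_cases hi : i = j
          · subst hi; omega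
          · rw [ho i hi]; exact h1 i
        · have hi' : i ≠ j := fun e => hj (e ▸ hi)
          rw [ho i hi']; exact h2 i hi
    have hins : x ∈ partialBox b v e (insert j J) ↔
        x ∈ partialBox b v e J ∧ b j ⬝ᵥ x < e j + b j ⬝ᵥ v j := by
      simp only [partialBox, Set.mem_ofPred_eq, Finset.forall_mem_insert]
      tauto
    simp only [Set.indicator_apply, hmem, hins]
    by_cases h1 : x ∈ partialBox b v e J <;>
      by_cases h2 : b j ⬝ᵥ x < e j + b j ⬝ᵥ v j <;> simp [h1, h2, not_le.2, not_lt.1]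

lemma IsDualPair.injective {b v : Fin d → Fin d → ℤ} (h : IsDualPair b v) :
    Function.Injective fun (x : Fin d → ℤ) i => b i ⬝ᵥ x := by
  have hdet : (Matrix.of b).det ≠ 0 := by
    have hmul : Matrix.of b * (Matrix.of v).transpose =
        Matrix.diagonal fun i => b i ⬝ᵥ v i := by
      ext i j
      rw [Matrix.mul_apply']
      by_cases hij : i = j
      · subst hij; simp; rfl
      · rw [Matrix.diagonal_apply_ne _ hij]; exact h.orthogonal i j hij
    intro h0
    have := congrArg Matrix.det hmul
    rw [Matrix.det_mul, h0, zero_mul, Matrix.det_diagonal] at this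
    exact (Finset.prod_pos fun i _ => h.pos i).ne this
  exact Matrix.mulVec_injective_of_det_ne_zero hdet

lemma IsDualPair.finite_box {b v : Fin d → Fin d → ℤ} (h : IsDualPair b v) (e : Fin d → ℤ) :
    (partialBox b v e Finset.univ).Finite := by
  refine Set.Finite.of_finite_image (f := fun (x : Fin d → ℤ) i => b i ⬝ᵥ x) ?_ h.injective.injOn
  refine (Set.finite_Icc e fun i => e i + b i ⬝ᵥ v i).subset ?_
  rintro _ ⟨x, hx, rfl⟩
  exact ⟨fun i => hx.1 i, fun i => (hx.2 i (Finset.mem_univ i)).le⟩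

/-- The Laurent polynomial of the lattice points of the fundamental parallelepiped. -/
noncomputable def IsDualPair.boxSum {b v : Fin d → Fin d → ℤ} (h : IsDualPair b v) (e : Fin d → ℤ) :
    Laurent d :=
  ∑ x ∈ (h.finite_box e).toFinset, AddMonoidAlgebra.single x 1

lemma IsDualPair.coeff_boxSum {b v : Fin d → Fin d → ℤ} (h : IsDualPair b v) (e : Fin d → ℤ) :
    (fun x => (h.boxSum e).coeff x) = (partialBox b v e Finset.univ).indicator 1 := by
  classical
  ext x
  simp [boxSum, Finsupp.single_apply, Set.indicator_apply]

lemma IsDualPair.isExpansionOf {b v : Fin d → Fin d → ℤ} (h : IsDualPair b v) (e : Fin d → ℤ) :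
    IsExpansionOf ({x | ∀ i, e i ≤ b i ⬝ᵥ x}.indicator 1)
      (algebraMap (Laurent d) (RationalFunction d) (h.boxSum e) /
        algebraMap (Laurent d) (RationalFunction d) (denominator v Finset.univ)) :=
  ⟨_, _, h.denominator_ne_zero _, by rw [h.laurentMul_denominator, h.coeff_boxSum], rfl⟩

/-- Since the values of `b i` are integers, `x ↦ ∑ v i - x` carries the box with lower corner `1 -
e` bijectively onto the one with lower corner `e`. -/
lemma IsDualPair.single_mul_invVars_boxSum {b v : Fin d → Fin d → ℤ} (h : IsDualPair b v)
    (e : Fin d → ℤ) :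
    AddMonoidAlgebra.single (∑ i, v i) 1 * Laurent.invVars d (h.boxSum fun i => 1 - e i) =
      h.boxSum e := by
  have hsum (i) : b i ⬝ᵥ ∑ j, v j = b i ⬝ᵥ v i := by
    rw [dotProduct_sum]
    exact Finset.sum_eq_single i (fun j _ hj => h.orthogonal i j hj.symm) (by simp)
  rw [boxSum, boxSum, map_sum, Finset.mul_sum]
  refine Finset.sum_bij' (fun x _ => ∑ i, v i - x) (fun x _ => ∑ i, v i - x) ?_ ?_ ?_ ?_ ?_
  · simp only [Set.Finite.mem_toFinset, partialBox, Set.mem_ofPred_eq, dotProduct_sub, hsum,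
      Finset.mem_univ, true_implies]
    rintro x ⟨h1, h2⟩
    exact ⟨fun i => by have := h1 i; have := h2 i; omega,
      fun i => by have := h1 i; have := h2 i; omega⟩
  · simp only [Set.Finite.mem_toFinset, partialBox, Set.mem_ofPred_eq, dotProduct_sub, hsum,
      Finset.mem_univ, true_implies]
    rintro x ⟨h1, h2⟩
    exact ⟨fun i => by have := h1 i; have := h2 i; omega,
      fun i => by have := h1 i; have := h2 i; omega⟩
  · simp
  · simp
  · intro x _
    rw [Laurent.invVars_single, AddMonoidAlgebra.single_mul_single, ← sub_eq_add_neg, one_mul]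

/-- Factor by factor, `x^v (1 - x^(-v)) = -(1 - x^v)`; this is the source of the sign `(-1)^d`. -/
lemma single_mul_invVars_denominator (v : Fin d → Fin d → ℤ) :
    AddMonoidAlgebra.single (∑ i, v i) 1 * Laurent.invVars d (denominator v Finset.univ) =
      (-1) ^ d * denominator v Finset.univ := by
  have hprod : (AddMonoidAlgebra.single (∑ i, v i) 1 : Laurent d) =
      ∏ i, AddMonoidAlgebra.single (v i) 1 := by
    induction (Finset.univ : Finset (Fin d)) using Finset.cons_induction with
    | empty => simp [AddMonoidAlgebra.one_def]
    | cons i s hi ih =>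
      rw [Finset.sum_cons, Finset.prod_cons, ← ih, AddMonoidAlgebra.single_mul_single, one_mul]
  have hconst : (-1 : Laurent d) ^ d = ∏ _i : Fin d, (-1) := by simp
  rw [hprod, hconst, denominator, map_prod, ← Finset.prod_mul_distrib, ← Finset.prod_mul_distrib]
  refine Finset.prod_congr rfl fun i _ => ?_
  rw [map_sub, map_one, Laurent.invVars_single, mul_sub, AddMonoidAlgebra.single_mul_single,
    add_neg_cancel, one_mul, ← AddMonoidAlgebra.one_def]
  ring

/-- Reciprocity for half-open simplicial cones. -/
lemma IsDualPair.reciprocal {b v : Fin d → Fin d → ℤ} (h : IsDualPair b v) (e : Fin d → ℤ) :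
    Reciprocal {x | ∀ i, e i ≤ b i ⬝ᵥ x} {x | ∀ i, 1 - e i ≤ b i ⬝ᵥ x} := by
  refine ⟨_, _, h.isExpansionOf e, h.isExpansionOf fun i => 1 - e i, ?_⟩
  have inj := IsFractionRing.injective (Laurent d) (RationalFunction d)
  have h1 := congrArg (algebraMap (Laurent d) (RationalFunction d))
    (h.single_mul_invVars_boxSum e)
  have h2 := congrArg (algebraMap (Laurent d) (RationalFunction d))
    (single_mul_invVars_denominator v)
  have hden : algebraMap (Laurent d) (RationalFunction d) (denominator v Finset.univ) ≠ 0 :=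
    (map_ne_zero_iff _ inj).2 (h.denominator_ne_zero _)
  have hinv : algebraMap (Laurent d) (RationalFunction d)
      (Laurent.invVars d (denominator v Finset.univ)) ≠ 0 :=
    (map_ne_zero_iff _ inj).2
      ((map_ne_zero_iff _ (Laurent.invVars d).injective).2 (h.denominator_ne_zero _))
  rw [map_mul, map_mul, map_pow, map_neg, map_one] at h2
  rw [map_mul] at h1
  rw [RationalFunction.invVars_div, ← h1, ← mul_div_assoc, div_eq_div_iff hden hinv]
  linear_combination (algebraMap (Laurent d) (RationalFunction d)
    (Laurent.invVars d (h.boxSum fun i => 1 - e i))) * h2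

end Simplicial

end StanleyReciprocity

namespace StanleyReciprocity

/-! ### Half-open cones cut by finitely many half-spaces -/

section HalfOpen

variable {d : ℕ}

/-- The value of an integral form at the lattice point `x`, perturbed infinitesimally in the
direction of the functional `φ`. -/
def perturbedEval (φ : (Fin d → ℤ) →+ ℝ) (x : Fin d → ℤ) : (Fin d → ℤ) →+ ℤ ×ₗ ℝ where
  toFun a := toLex (a ⬝ᵥ x, φ a)
  map_zero' := by simp
  map_add' a a' := by simp [add_dotProduct, ← toLex_add]

/-- The lattice points of the closed half-space `a ≥ 0` if `φ a > 0`, and of the open half-space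
`a > 0` otherwise. -/
def halfSpace (φ : (Fin d → ℤ) →+ ℝ) (a : Fin d → ℤ) : Set (Fin d → ℤ) :=
  {x | 0 < perturbedEval φ x a}

lemma mem_halfSpace {φ : (Fin d → ℤ) →+ ℝ} {a x : Fin d → ℤ} :
    x ∈ halfSpace φ a ↔ 0 < a ⬝ᵥ x ∨ a ⬝ᵥ x = 0 ∧ 0 < φ a := by
  change toLex (0, 0) < toLex (a ⬝ᵥ x, φ a) ↔ _
  rw [Prod.Lex.toLex_lt_toLex, eq_comm (a := (0 : ℤ))]

/-- Injectivity of `φ` excludes a perturbed value of zero, so every lattice point is strictly on one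
side. -/
lemma mem_halfSpace_neg {φ : (Fin d → ℤ) →+ ℝ} (hφ : Function.Injective φ) {a x : Fin d → ℤ}
    (ha : a ≠ 0) : x ∈ halfSpace φ (-a) ↔ x ∉ halfSpace φ a := by
  have h : φ a ≠ 0 := (map_ne_zero_iff _ hφ).2 ha
  have h' : perturbedEval φ x a ≠ 0 := fun e => h (congrArg (fun p => (ofLex p).2) e)
  change 0 < perturbedEval φ x (-a) ↔ ¬ 0 < perturbedEval φ x a
  rw [map_neg, neg_pos, not_lt]
  exact ⟨le_of_lt, fun hle => lt_of_le_of_ne hle h'⟩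

/-- Membership is positivity in the ordered group `ℤ ×ₗ ℝ`, so boundary points need no separate
treatment. -/
lemma mem_halfSpace_of_combination {φ : (Fin d → ℤ) →+ ℝ} {ι : Type*} [Fintype ι]
    {a x : Fin d → ℤ} {b : ι → Fin d → ℤ} {c : ℤ} {k : ι → ℤ} (hc : 0 < c) (hk : ∀ i, 0 ≤ k i)
    (hk' : ∃ i, 0 < k i) (h : c • a = ∑ i, k i • b i) (hx : ∀ i, x ∈ halfSpace φ (b i)) :
    x ∈ halfSpace φ a := by
  have e := congrArg (perturbedEval φ x) h
  rw [map_zsmul, map_sum] at e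
  simp only [map_zsmul] at e
  have hpos : 0 < c • perturbedEval φ x a := by
    rw [e]
    obtain ⟨i, hi⟩ := hk'
    exact Finset.sum_pos' (fun j _ => zsmul_nonneg (le_of_lt (hx j)) (hk j))
      ⟨i, Finset.mem_univ i, zsmul_pos (hx i) hi⟩
  change 0 < perturbedEval φ x a
  by_contra hneg
  exact absurd hpos (not_lt.2 (by
    have := zsmul_nonneg (neg_nonneg.2 (not_lt.1 hneg)) hc.le
    rwa [zsmul_neg, neg_nonneg] at this))

lemma mem_halfSpace_of_combination_pair {φ : (Fin d → ℤ) →+ ℝ} {a a₁ a₂ x : Fin d → ℤ}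
    {c k₁ k₂ : ℤ} (hc : 0 < c) (hk₁ : 0 < k₁) (hk₂ : 0 < k₂) (h : c • a = k₁ • a₁ + k₂ • a₂)
    (h₁ : x ∈ halfSpace φ a₁) (h₂ : x ∈ halfSpace φ a₂) : x ∈ halfSpace φ a :=
  mem_halfSpace_of_combination (b := ![a₁, a₂]) (k := ![k₁, k₂]) hc
    (by simp [Fin.forall_fin_two, hk₁.le, hk₂.le]) ⟨0, by simpa using hk₁⟩ (by simpa using h)
    (by simp [Fin.forall_fin_two, h₁, h₂])

/-- The lattice points of the half-open cone with facets `b` cut by the half-spaces of the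
forms in `L`. -/
def halfOpenCone (φ : (Fin d → ℤ) →+ ℝ) (b : Fin d → Fin d → ℤ) (L : List (Fin d → ℤ)) :
    Set (Fin d → ℤ) :=
  {x | (∀ i, x ∈ halfSpace φ (b i)) ∧ ∀ a ∈ L, x ∈ halfSpace φ a}

lemma IsDualPair.symm {b v : Fin d → Fin d → ℤ} (h : IsDualPair b v) : IsDualPair v b :=
  ⟨fun i => by rw [dotProduct_comm]; exact h.pos i,
    fun i j hij => by rw [dotProduct_comm]; exact h.orthogonal j i hij.symm⟩

lemma IsDualPair.facet_ne_zero {b v : Fin d → Fin d → ℤ} (h : IsDualPair b v) (i : Fin d) :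
    b i ≠ 0 := fun e => by
  have := h.pos i
  simp [e] at this

lemma IsDualPair.reciprocal_halfOpenCone_nil {φ : (Fin d → ℤ) →+ ℝ} (hφ : Function.Injective φ)
    {b v : Fin d → Fin d → ℤ} (h : IsDualPair b v) :
    Reciprocal (halfOpenCone φ b []) (halfOpenCone (-φ) b []) := by
  -- A closed facet is `b i ⬝ᵥ x ≥ 0`, an open one `b i ⬝ᵥ x ≥ 1`; passing to `-φ` exchanges them,
  -- that is, `e` and `1 - e`.
  convert h.reciprocal (fun i => if 0 < φ (b i) then 0 else 1) using 1
  · ext x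
    simp only [halfOpenCone, Set.mem_ofPred_eq, List.not_mem_nil, false_implies, implies_true,
      and_true, mem_halfSpace]
    refine forall_congr' fun i => ?_
    split_ifs with h0
    · simp only [h0, and_true]; omega
    · simp only [h0, and_false, or_false]; omega
  · ext x
    simp only [halfOpenCone, Set.mem_ofPred_eq, List.not_mem_nil, false_implies, implies_true,
      and_true, mem_halfSpace, AddMonoidHom.neg_apply, neg_pos]
    refine forall_congr' fun i => ?_
    have hne : φ (b i) ≠ 0 := (map_ne_zero_iff _ hφ).2 (h.facet_ne_zero i)
    split_ifs with h0
    · simp only [h0.not_gt, and_false, or_false]; omega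
    · simp only [lt_of_le_of_ne (not_lt.1 h0) hne, and_true]; omega

/-- A form that is nonnegative on the generators is nonnegative on the half-open cone. -/
lemma IsDualPair.mem_halfSpace_of_nonneg {φ : (Fin d → ℤ) →+ ℝ} {b v : Fin d → Fin d → ℤ}
    (h : IsDualPair b v) {a x : Fin d → ℤ} (ha : a ≠ 0) (hav : ∀ i, 0 ≤ a ⬝ᵥ v i)
    (hx : ∀ i, x ∈ halfSpace φ (b i)) : x ∈ halfSpace φ a := by
  have hpos (i : Fin d) : 0 < ∏ j ∈ Finset.univ.erase i, b j ⬝ᵥ v j :=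
    Finset.prod_pos fun j _ => h.pos j
  -- This is the expansion `a = ∑ (a ⬝ᵥ v i) / (b i ⬝ᵥ v i) • b i` with denominators cleared.
  refine mem_halfSpace_of_combination (c := ∏ j, b j ⬝ᵥ v j)
    (k := fun i => (a ⬝ᵥ v i) * ∏ j ∈ Finset.univ.erase i, b j ⬝ᵥ v j)
    (Finset.prod_pos fun j _ => h.pos j) (fun i => mul_nonneg (hav i) (hpos i).le) ?_ ?_ hx
  · by_contra! hle
    refine ha (h.symm.injective (funext fun i => ?_))
    have := hle i
    have h0 : a ⬝ᵥ v i ≤ 0 := by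
      by_contra! hlt
      exact absurd (mul_pos hlt (hpos i)) (not_lt.2 this)
    simp only [dotProduct_zero]
    rw [dotProduct_comm]
    exact le_antisymm h0 (hav i)
  · refine h.symm.injective (funext fun j => ?_)
    simp only [dotProduct_smul, dotProduct_sum, smul_eq_mul]
    rw [Finset.sum_eq_single j (fun i _ hij => by rw [h.symm.orthogonal j i hij.symm, mul_zero])
      (by simp), ← Finset.mul_prod_erase _ _ (Finset.mem_univ j), dotProduct_comm (v j) a,
      dotProduct_comm (v j) (b j)]
    ring

/-- The facet form that separates the two parts of a simplicial cone subdivided at the ray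
`α • v j + β • v i`. -/
def splitForm (b v : Fin d → Fin d → ℤ) (i j : Fin d) (α β : ℤ) : Fin d → ℤ :=
  (α * (b j ⬝ᵥ v j)) • b i - (β * (b i ⬝ᵥ v i)) • b j

lemma splitForm_swap (b v : Fin d → Fin d → ℤ) (i j : Fin d) (α β : ℤ) :
    splitForm b v j i β α = -splitForm b v i j α β := by
  simp [splitForm]

lemma IsDualPair.splitForm_dotProduct_left {b v : Fin d → Fin d → ℤ} (h : IsDualPair b v)
    {i j : Fin d} (hij : i ≠ j) (α β : ℤ) :
    splitForm b v i j α β ⬝ᵥ v i = α * (b j ⬝ᵥ v j) * (b i ⬝ᵥ v i) := by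
  simp only [splitForm, sub_dotProduct, smul_dotProduct, h.orthogonal j i hij.symm, smul_eq_mul]
  ring

lemma IsDualPair.splitForm_ne_zero {b v : Fin d → Fin d → ℤ} (h : IsDualPair b v) {i j : Fin d}
    (hij : i ≠ j) {α β : ℤ} (hα : 0 < α) : splitForm b v i j α β ≠ 0 := fun e => by
  have := h.splitForm_dotProduct_left hij α β
  rw [e, zero_dotProduct] at this
  exact (mul_pos (mul_pos hα (h.pos j)) (h.pos i)).ne this

/-- The new ray replaces `v j`. Of the facet forms, only `b i` fails the orthogonality required with
it, and `splitForm` vanishes there while staying positive on `v i`. -/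
lemma IsDualPair.split {b v : Fin d → Fin d → ℤ} (h : IsDualPair b v) {i j : Fin d} (hij : i ≠ j)
    {α β : ℤ} (hα : 0 < α) :
    IsDualPair (Function.update b i (splitForm b v i j α β))
      (Function.update v j (α • v j + β • v i)) := by
  have hdot (k l : Fin d) (hkl : k ≠ l) := h.orthogonal k l hkl
  constructor
  · intro k
    by_cases hk : k = i
    · subst hk
      rw [Function.update_self, Function.update_of_ne hij, h.splitForm_dotProduct_left hij]
      exact mul_pos (mul_pos hα (h.pos j)) (h.pos k)
    · rw [Function.update_of_ne hk]
      by_cases hkj : k = j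
      · subst hkj
        rw [Function.update_self, dotProduct_add, dotProduct_smul, dotProduct_smul,
          hdot k i hij.symm]
        simpa using mul_pos hα (h.pos k)
      · rw [Function.update_of_ne hkj]
        exact h.pos k
  · intro k l hkl
    by_cases hk : k = i
    · subst hk
      rw [Function.update_self]
      by_cases hl : l = j
      · subst hl
        simp only [Function.update_self, splitForm, sub_dotProduct, smul_dotProduct,
          dotProduct_add, dotProduct_smul, hdot k l hij, hdot l k hij.symm, smul_eq_mul]
        ring
      · simp only [Function.update_of_ne hl, splitForm, sub_dotProduct, smul_dotProduct,
          hdot k l hkl, hdot j l (Ne.symm hl), smul_zero, sub_zero]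
    · rw [Function.update_of_ne hk]
      by_cases hl : l = j
      · subst hl
        simp only [Function.update_self, dotProduct_add, dotProduct_smul, hdot k l hkl,
          hdot k i hk, smul_zero, add_zero]
      · rw [Function.update_of_ne hl]
        exact hdot k l hkl

/-- The old facet `b i` becomes redundant, because a positive multiple of it is a positive
combination of `splitForm` and `b j`. -/
lemma IsDualPair.halfOpenCone_split {b v : Fin d → Fin d → ℤ} (h : IsDualPair b v) {i j : Fin d}
    (hij : i ≠ j) {α β : ℤ} (hα : 0 < α) (hβ : 0 < β) (φ : (Fin d → ℤ) →+ ℝ)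
    (L : List (Fin d → ℤ)) :
    halfOpenCone φ (Function.update b i (splitForm b v i j α β)) L =
      halfOpenCone φ b L ∩ halfSpace φ (splitForm b v i j α β) := by
  ext x
  constructor
  · rintro ⟨h1, h2⟩
    have hs : x ∈ halfSpace φ (splitForm b v i j α β) := by simpa using h1 i
    refine ⟨⟨fun k => ?_, h2⟩, hs⟩
    by_cases hk : k = i
    · subst hk
      have hj : x ∈ halfSpace φ (b j) := by
        simpa [Function.update_of_ne hij.symm] using h1 j
      refine mem_halfSpace_of_combination_pair (c := α * (b j ⬝ᵥ v j)) (k₁ := 1)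
        (k₂ := β * (b k ⬝ᵥ v k)) (mul_pos hα (h.pos j)) one_pos (mul_pos hβ (h.pos k)) ?_ hs hj
      simp [splitForm]
    · simpa [Function.update_of_ne hk] using h1 k
  · rintro ⟨⟨h1, h2⟩, hs⟩
    refine ⟨fun k => ?_, h2⟩
    by_cases hk : k = i
    · subst hk
      simpa using hs
    · simpa [Function.update_of_ne hk] using h1 k

/-- The separating forms of the two pieces are opposite, so their half-spaces are complementary for
`φ` and for `-φ` alike. -/
lemma IsDualPair.reciprocal_of_split {φ : (Fin d → ℤ) →+ ℝ} (hφ : Function.Injective φ)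
    {b v : Fin d → Fin d → ℤ} (h : IsDualPair b v) {i j : Fin d} (hij : i ≠ j) {α β : ℤ}
    (hα : 0 < α) (hβ : 0 < β) (L : List (Fin d → ℤ))
    (h₁ : Reciprocal (halfOpenCone φ (Function.update b i (splitForm b v i j α β)) L)
      (halfOpenCone (-φ) (Function.update b i (splitForm b v i j α β)) L))
    (h₂ : Reciprocal (halfOpenCone φ (Function.update b j (splitForm b v j i β α)) L)
      (halfOpenCone (-φ) (Function.update b j (splitForm b v j i β α)) L)) :
    Reciprocal (halfOpenCone φ b L) (halfOpenCone (-φ) b L) := by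
  have hne := h.splitForm_ne_zero hij (β := β) hα
  have hφ' : Function.Injective (-φ) := fun x y hxy => hφ (neg_injective hxy)
  have hcompl (ψ : (Fin d → ℤ) →+ ℝ) (hψ : Function.Injective ψ) :
      halfSpace ψ (splitForm b v j i β α) = (halfSpace ψ (splitForm b v i j α β))ᶜ := by
    ext x
    rw [splitForm_swap, mem_halfSpace_neg hψ hne, Set.mem_compl_iff]
  rw [h.halfOpenCone_split hij hα hβ, h.halfOpenCone_split hij hα hβ] at h₁
  rw [h.halfOpenCone_split hij.symm hβ hα, h.halfOpenCone_split hij.symm hβ hα, hcompl φ hφ,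
    hcompl (-φ) hφ'] at h₂
  have := h₁.union h₂
    (disjoint_compl_right.mono Set.inter_subset_right Set.inter_subset_right)
    (disjoint_compl_right.mono Set.inter_subset_right Set.inter_subset_right)
  rwa [Set.inter_union_compl, Set.inter_union_compl] at this

/-- Moving a generator into the kernel of `a` lowers the number of generators outside it. -/
lemma card_dotProduct_ne_zero_update_lt {a : Fin d → ℤ} {v : Fin d → Fin d → ℤ} {j : Fin d}
    {u : Fin d → ℤ} (hj : a ⬝ᵥ v j ≠ 0) (hu : a ⬝ᵥ u = 0) :
    (Finset.univ.filter fun k => a ⬝ᵥ Function.update v j u k ≠ 0).card <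
      (Finset.univ.filter fun k => a ⬝ᵥ v k ≠ 0).card := by
  refine Finset.card_lt_card (Finset.ssubset_iff_of_subset ?_ |>.2 ⟨j, by simpa using hj, ?_⟩)
  · intro k
    by_cases hk : k = j
    · subst hk; simp [hu]
    · simp [Function.update_of_ne hk]
  · simp [hu]

/-- Reciprocity for half-open cones that are cut out of a simplicial cone by half-spaces in
general position with respect to the perturbation `φ`. -/
lemma IsDualPair.reciprocal_halfOpenCone {φ : (Fin d → ℤ) →+ ℝ} (hφ : Function.Injective φ)
    (L : List (Fin d → ℤ)) (hL : ∀ a ∈ L, a ≠ 0) {b v : Fin d → Fin d → ℤ} (h : IsDualPair b v) :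
    Reciprocal (halfOpenCone φ b L) (halfOpenCone (-φ) b L) := by
  have hφ' : Function.Injective (-φ) := fun x y hxy => hφ (neg_injective hxy)
  induction L generalizing b v with
  | nil => exact h.reciprocal_halfOpenCone_nil hφ
  | cons a L ihL =>
    have ha : a ≠ 0 := hL a (by simp)
    have ihL' {b v} (h : IsDualPair b v) := ihL (fun a' ha' => hL a' (by simp [ha'])) h
    -- Inner induction on the number of generators off the hyperplane of `a`. A form of constant
    -- sign on the generators is vacuous or gives the empty set; otherwise the cone is split.
    induction hn : (Finset.univ.filter fun k => a ⬝ᵥ v k ≠ 0).card using Nat.strong_induction_on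
      generalizing b v with
    | _ n ih =>
      by_cases hnonneg : ∀ k, 0 ≤ a ⬝ᵥ v k
      · have (ψ : (Fin d → ℤ) →+ ℝ) : halfOpenCone ψ b (a :: L) = halfOpenCone ψ b L := by
          ext x
          simp only [halfOpenCone, Set.mem_ofPred_eq, List.forall_mem_cons]
          exact ⟨fun hx => ⟨hx.1, hx.2.2⟩,
            fun hx => ⟨hx.1, h.mem_halfSpace_of_nonneg ha hnonneg hx.1, hx.2⟩⟩
        rw [this, this]
        exact ihL' h
      by_cases hnonpos : ∀ k, a ⬝ᵥ v k ≤ 0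
      · have (ψ : (Fin d → ℤ) →+ ℝ) (hψ : Function.Injective ψ) :
            halfOpenCone ψ b (a :: L) = ∅ := by
          refine Set.eq_empty_iff_forall_notMem.2 fun x hx => ?_
          have hneg : x ∈ halfSpace ψ (-a) :=
            h.mem_halfSpace_of_nonneg (neg_ne_zero.2 ha) (by simpa using hnonpos) hx.1
          exact (mem_halfSpace_neg hψ ha).1 hneg (hx.2 a (by simp))
        rw [this φ hφ, this (-φ) hφ']
        exact reciprocal_empty
      push Not at hnonneg hnonpos
      obtain ⟨j, hj⟩ := hnonneg
      obtain ⟨i, hi⟩ := hnonpos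
      have hij : i ≠ j := by rintro rfl; omega
      have hj' : 0 < -(a ⬝ᵥ v j) := by omega
      -- The ray `(a ⬝ᵥ v i) • v j - (a ⬝ᵥ v j) • v i` lies in the kernel of `a`, and in each piece
      -- it replaces a generator outside that kernel.
      refine h.reciprocal_of_split hφ hij hi hj' _
        (ih _ ?_ (h.split hij hi) rfl) (ih _ ?_ (h.split hij.symm hj') rfl)
      · rw [← hn]
        refine card_dotProduct_ne_zero_update_lt hj.ne ?_
        simp only [dotProduct_add, dotProduct_smul, smul_eq_mul]
        ring
      · rw [← hn]
        refine card_dotProduct_ne_zero_update_lt hi.ne' ?_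
        simp only [dotProduct_add, dotProduct_smul, smul_eq_mul]
        ring

end HalfOpen

end StanleyReciprocity

namespace StanleyReciprocity

/-! ### The rational cone as a half-open cone -/

section RationalCone

variable {m d : ℕ}

/-- The evaluation of integral forms at a real vector. -/
def formEval (r : Fin d → ℝ) : (Fin d → ℤ) →+ ℝ where
  toFun a := (fun k => (a k : ℝ)) ⬝ᵥ r
  map_zero' := by simp [dotProduct]
  map_add' a a' := by simp [dotProduct, add_mul, Finset.sum_add_distrib]

lemma formEval_add_smul (r s : Fin d → ℝ) (t : ℝ) (a : Fin d → ℤ) :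
    formEval (r + t • s) a = formEval r a + t * formEval s a := by
  simp [formEval, dotProduct_add, dotProduct_smul]

lemma formEval_intCast (x a : Fin d → ℤ) :
    formEval (fun k => (x k : ℝ)) a = ((a ⬝ᵥ x : ℤ) : ℝ) := by
  simp [formEval, dotProduct]

lemma continuous_formEval (a : Fin d → ℤ) : Continuous fun r : Fin d → ℝ => formEval r a := by
  change Continuous fun r : Fin d → ℝ => (fun k => (a k : ℝ)) ⬝ᵥ r
  fun_prop

lemma mem_rationalCone {A : Matrix (Fin m) (Fin d) ℤ} {r : Fin d → ℝ} :
    r ∈ rationalCone A ↔ ∀ i, formEval r (A i) ≤ 0 := Iff.rfl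

lemma zero_mem_rationalCone (A : Matrix (Fin m) (Fin d) ℤ) : 0 ∈ rationalCone A :=
  mem_rationalCone.2 fun i => by simp [formEval]

lemma convex_rationalCone (A : Matrix (Fin m) (Fin d) ℤ) : Convex ℝ (rationalCone A) := by
  intro r hr s hs p q hp hq _
  rw [mem_rationalCone] at *
  intro i
  have e : formEval (p • r + q • s) (A i) = p * formEval r (A i) + q * formEval s (A i) := by
    simp [formEval, dotProduct_add, dotProduct_smul]
  rw [e]
  nlinarith [hr i, hs i, mul_nonneg hp (neg_nonneg.2 (hr i)), mul_nonneg hq (neg_nonneg.2 (hs i))]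

lemma interior_rationalCone_nonempty (A : Matrix (Fin m) (Fin d) ℤ)
    (hdim : Module.finrank ℝ (Submodule.span ℝ (rationalCone A)) = d) :
    (interior (rationalCone A)).Nonempty := by
  rw [(convex_rationalCone A).interior_nonempty_iff_affineSpan_eq_top,
    AffineSubspace.affineSpan_eq_top_iff_vectorSpan_eq_top_of_nonempty _ _ _
      ⟨0, zero_mem_rationalCone A⟩,
    vectorSpan_eq_span_vsub_set_right ℝ (zero_mem_rationalCone A)]
  simp only [vsub_eq_sub, sub_zero, Set.image_id']
  exact Submodule.eq_top_of_finrank_eq (by simpa using hdim)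

/-- An open set contains a vector at which no nonzero integral form vanishes. -/
lemma exists_mem_injective_formEval {U : Set (Fin d → ℝ)} (hU : IsOpen U) (hne : U.Nonempty) :
    ∃ w ∈ U, Function.Injective (formEval w) := by
  have hnull : MeasureTheory.volume
      (⋃ a : {a : Fin d → ℤ // a ≠ 0}, {w : Fin d → ℝ | formEval w a = 0}) = 0 := by
    -- Countably many proper hyperplanes are null, whereas a nonempty open set has positive measure.
    refine MeasureTheory.measure_iUnion_null fun a => ?_
    have hker : {w : Fin d → ℝ | formEval w a = 0} =
        LinearMap.ker (dotProductBilin ℝ ℝ (fun k => (a.1 k : ℝ))) := rfl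
    rw [hker]
    refine MeasureTheory.Measure.addHaar_submodule _ _ fun htop => a.2 ?_
    ext k
    have : (Pi.single k 1 : Fin d → ℝ) ∈
        LinearMap.ker (dotProductBilin ℝ ℝ (fun k => (a.1 k : ℝ))) := htop ▸ Submodule.mem_top
    simpa using this
  obtain ⟨w, hw, hw'⟩ : ∃ w ∈ U, w ∉
      ⋃ a : {a : Fin d → ℤ // a ≠ 0}, {w : Fin d → ℝ | formEval w a = 0} := by
    by_contra! hsub
    exact (hU.measure_pos MeasureTheory.volume hne).ne'
      (MeasureTheory.measure_mono_null hsub hnull)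
  refine ⟨w, hw, (injective_iff_map_eq_zero _).2 fun a ha => ?_⟩
  by_contra ha'
  exact hw' (Set.mem_iUnion.2 ⟨⟨a, ha'⟩, ha⟩)

lemma mem_interior_rationalCone {A : Matrix (Fin m) (Fin d) ℤ} {w r : Fin d → ℝ}
    (hw : w ∈ interior (rationalCone A)) (hinj : Function.Injective (formEval w)) :
    r ∈ interior (rationalCone A) ↔ ∀ i, A i ≠ 0 → formEval r (A i) < 0 := by
  constructor
  · intro hr i hi
    -- For small `t > 0` the point `r - t • w` is still in the cone, so `A i` at `r` is at most `t`
    -- times its negative value at `w`.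
    have hlim : Filter.Tendsto (fun t : ℝ => r + t • (-w)) (nhds 0) (nhds r) := by
      have : Continuous fun t : ℝ => r + t • (-w) := by fun_prop
      simpa using this.tendsto 0
    have hev := (hlim.eventually (mem_interior_iff_mem_nhds.1 hr)).filter_mono
      (nhdsWithin_le_nhds (s := Set.Ioi 0))
    obtain ⟨t, ht, ht0⟩ := (hev.and self_mem_nhdsWithin).exists
    have ht0 : 0 < t := ht0
    have h1 := mem_rationalCone.1 ht i
    have h2 : formEval w (A i) < 0 := lt_of_le_of_ne (mem_rationalCone.1 (interior_subset hw) i)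
      ((map_ne_zero_iff _ hinj).2 hi)
    rw [smul_neg, ← neg_smul, formEval_add_smul] at h1
    nlinarith [mul_pos ht0 (neg_pos.2 h2)]
  · intro h
    have hopen : IsOpen {r : Fin d → ℝ | ∀ i, A i ≠ 0 → formEval r (A i) < 0} := by
      simp only [Set.ofPred_forall]
      exact isOpen_iInter_of_finite fun i => isOpen_iInter_of_finite fun _ =>
        isOpen_lt (continuous_formEval _) continuous_const
    refine interior_maximal (fun s hs => mem_rationalCone.2 fun i => ?_) hopen h
    by_cases hi : A i = 0
    · simp [hi]
    · exact (hs i hi).le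

/-- A pointed cone has `d` linearly independent facet forms. -/
lemma exists_rows_det_ne_zero {A : Matrix (Fin m) (Fin d) ℤ}
    (hpointed : ContainsNoLine (rationalCone A)) :
    ∃ f : Fin d → Fin m, (A.submatrix f id).det ≠ 0 := by
  let R : Matrix (Fin m) (Fin d) ℝ := A.map Int.cast
  have hker (x : Fin d → ℝ) (hx : R.mulVec x = 0) : x = 0 := by
    by_contra hne
    -- A nonzero kernel vector would span a line inside the cone.
    refine hpointed ⟨0, x, hne, fun t i => ?_⟩
    change R.mulVec _ i ≤ 0
    simp [Matrix.mulVec_smul, hx]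
  have hrank : R.rank = d := by
    have := R.mulVecLin.finrank_range_add_finrank_ker
    rw [LinearMap.ker_eq_bot'.2 (by simpa using hker)] at this
    simpa [Matrix.rank] using this
  obtain ⟨κ, f, hf, hspan, hli⟩ := exists_linearIndependent' ℝ R.row
  have : Finite κ := Finite.of_injective f hf
  have : Fintype κ := Fintype.ofFinite κ
  have hcard : Fintype.card κ = d := by
    rw [← hrank, Matrix.rank_eq_finrank_span_row, ← hspan, finrank_span_eq_card hli]
  let e : Fin d ≃ κ := (Fintype.equivFinOfCardEq hcard).symm
  refine ⟨f ∘ e, fun h0 => ?_⟩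
  have hunit : IsUnit (R.submatrix (f ∘ e) id) :=
    Matrix.linearIndependent_rows_iff_isUnit.1 (hli.comp e e.injective)
  rw [Matrix.isUnit_iff_isUnit_det, isUnit_iff_ne_zero] at hunit
  refine hunit ?_
  have : R.submatrix (f ∘ e) id = (A.submatrix (f ∘ e) id).map (Int.castRingHom ℝ) := rfl
  rw [this, ← RingHom.mapMatrix_apply, ← RingHom.map_det, h0, map_zero]

/-- Linearly independent forms are the facets of a simplicial cone. -/
lemma exists_isDualPair {B : Matrix (Fin d) (Fin d) ℤ} (hB : B.det ≠ 0) :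
    ∃ v, IsDualPair (fun i => -B i) v := by
  -- The generators are adjugate columns; the additional factor `B.det` makes the diagonal pairings
  -- squares, hence positive.
  have key (i j : Fin d) : (-B i) ⬝ᵥ (fun k => -(B.det * B.adjugate k j)) =
      B.det * (B.det * (1 : Matrix (Fin d) (Fin d) ℤ) i j) := by
    have h := congrFun (congrFun B.mul_adjugate i) j
    rw [Matrix.mul_apply, Matrix.smul_apply, smul_eq_mul] at h
    rw [← h, Finset.mul_sum]
    exact Finset.sum_congr rfl fun k _ => by simp only [Pi.neg_apply]; ring
  refine ⟨fun j k => -(B.det * B.adjugate k j), fun i => ?_, fun i j hij => ?_⟩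
  · rw [key, Matrix.one_apply_eq, mul_one]
    exact mul_self_pos.2 hB
  · rw [key, Matrix.one_apply_ne hij, mul_zero, mul_zero]

/-- Stanley reciprocity for the lattice points of a pointed full-dimensional rational cone. -/
lemma reciprocal_rationalCone (A : Matrix (Fin m) (Fin d) ℤ)
    (hdim : Module.finrank ℝ (Submodule.span ℝ (rationalCone A)) = d)
    (hpointed : ContainsNoLine (rationalCone A)) :
    Reciprocal {x : Fin d → ℤ | (fun k => (x k : ℝ)) ∈ rationalCone A}
      {x : Fin d → ℤ | (fun k => (x k : ℝ)) ∈ interior (rationalCone A)} := by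
  obtain ⟨w, hw, hinj⟩ := exists_mem_injective_formEval isOpen_interior
    (interior_rationalCone_nonempty A hdim)
  obtain ⟨f, hf⟩ := exists_rows_det_ne_zero hpointed
  obtain ⟨v, hv⟩ := exists_isDualPair hf
  let L : List (Fin d → ℤ) := (List.ofFn fun i => -A i).filter (· ≠ 0)
  have hmemL (a : Fin d → ℤ) : a ∈ L ↔ ∃ i, A i ≠ 0 ∧ -A i = a := by
    simp only [L, List.mem_filter, List.mem_ofFn, decide_eq_true_eq]
    constructor
    · rintro ⟨⟨i, rfl⟩, h⟩
      exact ⟨i, neg_ne_zero.1 h, rfl⟩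
    · rintro ⟨i, h, rfl⟩
      exact ⟨⟨i, rfl⟩, neg_ne_zero.2 h⟩
  -- The facets of the simplicial cone are themselves among the forms in `L`, so they add no
  -- condition.
  have hmem (φ : (Fin d → ℤ) →+ ℝ) (x : Fin d → ℤ) :
      x ∈ halfOpenCone φ (fun i => -A.submatrix f id i) L ↔
        ∀ i, A i ≠ 0 → x ∈ halfSpace φ (-A i) := by
    constructor
    · exact fun hx i hi => hx.2 _ ((hmemL _).2 ⟨i, hi, rfl⟩)
    · refine fun hx => ⟨fun i => hx (f i) (neg_ne_zero.1 (hv.facet_ne_zero i)), fun a ha => ?_⟩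
      obtain ⟨i, hi, rfl⟩ := (hmemL a).1 ha
      exact hx i hi
  -- This sign makes the half-spaces of all `-A i` closed for `formEval w` and open for its
  -- negative.
  have hneg (i) (hi : A i ≠ 0) : formEval w (A i) < 0 :=
    lt_of_le_of_ne (mem_rationalCone.1 (interior_subset hw) i) ((map_ne_zero_iff _ hinj).2 hi)
  convert hv.reciprocal_halfOpenCone hinj L
    (fun a ha => by obtain ⟨i, hi, rfl⟩ := (hmemL a).1 ha; exact neg_ne_zero.2 hi) using 1
  · ext x
    rw [hmem, Set.mem_ofPred_eq, mem_rationalCone]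
    refine forall_congr' fun i => ?_
    rw [formEval_intCast, Int.cast_nonpos]
    by_cases hi : A i = 0
    · simp [hi]
    · have := hneg i hi
      simp only [mem_halfSpace, neg_dotProduct, map_neg, ne_eq, hi, not_false_eq_true,
        true_implies, neg_pos, this, and_true]
      omega
  · ext x
    rw [hmem, Set.mem_ofPred_eq, mem_interior_rationalCone hw hinj]
    refine forall_congr' fun i => forall_congr' fun hi => ?_
    have := hneg i hi
    rw [formEval_intCast, Int.cast_lt_zero]
    simp only [mem_halfSpace, neg_dotProduct, map_neg, AddMonoidHom.neg_apply, neg_neg, neg_pos,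
      this.not_gt, and_false, or_false]

end RationalCone

end StanleyReciprocity

theorem theorem1 {m d : ℕ} (A : Matrix (Fin m) (Fin d) ℤ)
    (hdim : Module.finrank ℝ (Submodule.span ℝ (StanleyReciprocity.rationalCone A)) = d)
    (hpointed : StanleyReciprocity.ContainsNoLine (StanleyReciprocity.rationalCone A)) :
    (∃! F : StanleyReciprocity.RationalFunction d,
      StanleyReciprocity.IsExpansionOf
        (StanleyReciprocity.latticeSeries (StanleyReciprocity.rationalCone A)) F) ∧
    (∃! G : StanleyReciprocity.RationalFunction d,
      StanleyReciprocity.IsExpansionOf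
        (StanleyReciprocity.latticeSeries (interior (StanleyReciprocity.rationalCone A))) G) ∧
    ∀ F G : StanleyReciprocity.RationalFunction d,
      StanleyReciprocity.IsExpansionOf
        (StanleyReciprocity.latticeSeries (StanleyReciprocity.rationalCone A)) F →
      StanleyReciprocity.IsExpansionOf
        (StanleyReciprocity.latticeSeries (interior (StanleyReciprocity.rationalCone A))) G →
      F = (-1) ^ d * StanleyReciprocity.RationalFunction.invVars d G := by
  obtain ⟨F, G, hF, hG, hFG⟩ := StanleyReciprocity.reciprocal_rationalCone A hdim hpointed
  refine ⟨⟨F, hF, fun F' hF' => hF'.unique hF⟩, ⟨G, hG, fun G' hG' => hG'.unique hG⟩,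
    fun F' G' hF' hG' => ?_⟩
  rw [hF'.unique hF, hG'.unique hG, hFG]
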